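/- Let $R$ be an integral domain with quotient field $K$. Say that an integral domain $D$ is \emph{essential} if there is a set $\Delta$ of prime ideals of $D$ such that $D_{p}$ is a valuation ring for every $p\in\Delta$ and $D=\bigcap_{p\in\Delta}D_{p}$ inside the quotient field of $D$ (the empty intersection being the quotient field), and that $R$ is \emph{locally essential} if the localization $R_{p}$ is essential for every prime ideal $p$ of $R$. Let ${\rm Int}(R)=\{f\in K[X] : f(R)\subseteq R\}$ be the ring of integer-valued polynomials over $R$. If $R$ is locally essential, then $$\dim({\rm Int}(R))=\dim(R[X]),$$ where $\dim$ denotes the Krull dimension, with values in $\{0,1,2,\dots\}\cup\{\infty\}$. -/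

import Mathlib

open scoped Polynomial

/-- An integral domain `R` is essential if, inside its quotient field, it is an intersection of
localizations `R_p` (with `p` prime) that are valuation rings. A valuation ring is local, so a
localization of `R` that is a valuation ring is always of the form `R_p`. -/
def IsEssentialDomain (R : Type*) [CommRing R] [IsDomain R] : Prop :=
  ∃ Δ : Set (PrimeSpectrum R),
    (∀ p ∈ Δ, ValuationRing (Localization.AtPrime p.asIdeal)) ∧
    (⨅ p ∈ Δ, Localization.subalgebra.ofField (FractionRing R) p.asIdeal.primeCompl
      p.asIdeal.primeCompl_le_nonZeroDivisors) = (⊥ : Subalgebra R (FractionRing R))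

/-- An integral domain is locally essential if its localization at every prime is essential. -/
def IsLocallyEssentialDomain (R : Type*) [CommRing R] [IsDomain R] : Prop :=
  ∀ p : PrimeSpectrum R, IsEssentialDomain (Localization.AtPrime p.asIdeal)

/-- The ring `Int(R) = {f ∈ K[X] : f(R) ⊆ R}`, as an `R`-subalgebra of `K[X]`. -/
def integerValuedPolynomials (R K : Type*) [CommRing R] [Field K] [Algebra R K] :
    Subalgebra R K[X] where
  carrier := {f | ∀ r : R, f.eval (algebraMap R K r) ∈ (algebraMap R K).range}
  mul_mem' {f g} hf hg r := by
    rw [Polynomial.eval_mul]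
    exact mul_mem (hf r) (hg r)
  add_mem' {f g} hf hg r := by
    rw [Polynomial.eval_add]
    exact add_mem (hf r) (hg r)
  algebraMap_mem' a r := by
    rw [Polynomial.algebraMap_apply, Polynomial.eval_C]
    exact ⟨a, rfl⟩

/-! Write `Int(R)` for the integer-valued polynomials and let `p` be a prime of `R`. If the maximal
ideal of `R_p` is in its defining family, `R_p` is a valuation ring. Otherwise `R_p` is an
intersection of localizations at primes `q` strictly below `p`. Each `R ⧸ q` is then infinite, so
Lagrange interpolation puts the coefficients of integer-valued polynomials in `R_q`, hence in `R_p`;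
thus `Int(R)` and `R[X]` agree after inverting the complement of `p`.

Now bound the height of a prime of either ring lying over `p`. In the second case it survives in the
common localization, so the dimension of the other ring bounds it. In the valuation case it is at
most `dim R + 1`, because a domain of transcendence degree at most one over a valuation ring `V` has
dimension at most `dim V + 1`; and `dim R + 1` is a lower bound for both dimensions. -/

/-! ### Primitive polynomials over a valuation ring. -/

theorem ValuationRing.exists_dvd_forall_of_finset {V : Type*} [CommRing V] [IsDomain V]
    [ValuationRing V] (s : Finset V) (hs : s.Nonempty) : ∃ a ∈ s, ∀ b ∈ s, a ∣ b := by
  induction hs using Finset.Nonempty.cons_induction with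
  | singleton a => exact ⟨a, by simp⟩
  | cons a s ha hs ih =>
    obtain ⟨c, hc, hcs⟩ := ih
    rcases ValuationRing.dvd_total a c with h | h
    · refine ⟨a, by simp, fun b hb => ?_⟩
      rcases Finset.mem_cons.1 hb with rfl | hb
      exacts [dvd_rfl, h.trans (hcs b hb)]
    · refine ⟨c, by simp [hc], fun b hb => ?_⟩
      rcases Finset.mem_cons.1 hb with rfl | hb
      exacts [h, hcs b hb]

theorem ValuationRing.exists_eq_C_mul {V : Type*} [CommRing V] [IsDomain V]
    [ValuationRing V] {g : V[X]} (hg : g ≠ 0) :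
    ∃ (c : V) (h : V[X]), g = Polynomial.C c * h ∧ ∃ i, h.coeff i = 1 := by
  classical
  obtain ⟨c, hc, hcs⟩ := exists_dvd_forall_of_finset (g.support.image g.coeff)
    ((Polynomial.support_nonempty.2 hg).image _)
  obtain ⟨i, hi, rfl⟩ := Finset.mem_image.1 hc
  obtain ⟨h, hh⟩ := Polynomial.C_dvd_iff_dvd_coeff (g.coeff i) g |>.2 fun j => by
    by_cases hj : g.coeff j = 0
    · simp [hj]
    · exact hcs _ (Finset.mem_image_of_mem _ (Polynomial.mem_support_iff.2 hj))
  refine ⟨g.coeff i, h, hh, i, ?_⟩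
  have := congrArg (Polynomial.coeff · i) hh
  simp only [Polynomial.coeff_C_mul] at this
  exact (mul_right_eq_self₀.1 this.symm).resolve_right (Polynomial.mem_support_iff.1 hi)

theorem ValuationRing.exists_eq_C_C_mul {V : Type*} [CommRing V] [IsDomain V]
    [ValuationRing V] {g : V[X][X]} (hg : g ≠ 0) :
    ∃ (c : V) (h : V[X][X]), g = Polynomial.C (Polynomial.C c) * h ∧
      ∃ i j, (h.coeff i).coeff j = 1 := by
  classical
  set s : Finset V := g.support.biUnion fun i => (g.coeff i).support.image (g.coeff i).coeff with hs
  have hmem : ∀ i j, (g.coeff i).coeff j ≠ 0 → (g.coeff i).coeff j ∈ s := fun i j hij => by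
    refine Finset.mem_biUnion.2 ⟨i, ?_, Finset.mem_image_of_mem _ (by simpa using hij)⟩
    rw [Polynomial.mem_support_iff]
    rintro h
    simp [h] at hij
  have hne : s.Nonempty := by
    obtain ⟨i, hi⟩ := Polynomial.support_nonempty.2 hg
    obtain ⟨j, hj⟩ := Polynomial.support_nonempty.2 (Polynomial.mem_support_iff.1 hi)
    exact ⟨_, hmem i j (by simpa using hj)⟩
  obtain ⟨c, hc, hcs⟩ := exists_dvd_forall_of_finset s hne
  obtain ⟨i, hi, hc⟩ := Finset.mem_biUnion.1 hc
  obtain ⟨j, hj, rfl⟩ := Finset.mem_image.1 hc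
  obtain ⟨h, hh⟩ := Polynomial.C_dvd_iff_dvd_coeff (Polynomial.C ((g.coeff i).coeff j)) g |>.2
    fun k => (Polynomial.C_dvd_iff_dvd_coeff _ _).2 fun l => by
      by_cases hj : (g.coeff k).coeff l = 0
      · simp [hj]
      · exact hcs _ (hmem _ _ hj)
  refine ⟨_, h, hh, i, j, ?_⟩
  have := congrArg (fun p => (Polynomial.coeff p i).coeff j) hh
  simp only [Polynomial.coeff_C_mul] at this
  exact (mul_right_eq_self₀.1 this.symm).resolve_right (Polynomial.mem_support_iff.1 hj)

/-! ### Dimension in transcendence degree at most one. -/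

theorem Algebra.exists_aevalAeval_eq_zero_of_trdeg_le_one {V T : Type*} [CommRing V] [IsDomain V]
    [CommRing T] [Algebra V T] (h : Algebra.trdeg V T ≤ 1) (t s : T) :
    ∃ g : V[X][X], g ≠ 0 ∧ Polynomial.aevalAeval t s g = 0 := by
  have hdep : ¬ AlgebraicIndependent V ![t, s] := fun hind => by
    have := hind.lift_cardinalMk_le_trdeg.trans (Cardinal.lift_le.2 h)
    simp at this
  rw [algebraicIndependent_iff] at hdep
  push Not at hdep
  obtain ⟨p, hp, hp0⟩ := hdep
  refine ⟨(Polynomial.Bivariate.equivMvPolynomial V).symm p, by simpa using hp0, ?_⟩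
  rw [← hp, ← AlgEquiv.coe_toAlgHom, ← AlgHom.comp_apply]
  congr 1
  ext i
  fin_cases i <;> simp

/-- The residue ring `T ⧸ Q` is algebraic over `V` modulo a polynomial with a unit coefficient. -/
def Ideal.ResidueAlgebraic (V : Type*) {T : Type*} [CommRing V] [CommRing T] [Algebra V T]
    (Q : Ideal T) : Prop :=
  ∀ t : T, ∃ h : V[X], (∃ i, h.coeff i = 1) ∧ Polynomial.aeval t h ∈ Q

/-- Asking for a coefficient equal to 1, not merely one nonzero modulo `Q`, makes the condition on
`h` independent of `Q`. -/
theorem Ideal.ResidueAlgebraic.mono {V T : Type*} [CommRing V] [CommRing T] [Algebra V T]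
    {Q Q' : Ideal T} (h : Q.ResidueAlgebraic V) (hQ : Q ≤ Q') : Q'.ResidueAlgebraic V :=
  fun t => (h t).imp fun _ hh => ⟨hh.1, hQ hh.2⟩

theorem Ideal.ResidueAlgebraic.comap_lt_comap {V T : Type*} [CommRing V] [CommRing T]
    [Algebra V T] {Q Q' : Ideal T} [Q.IsPrime] (h : Q.ResidueAlgebraic V) (hQ : Q < Q') :
    Q.comap (algebraMap V T) < Q'.comap (algebraMap V T) := by
  obtain ⟨hle, s, hs', hs⟩ := SetLike.lt_iff_le_and_exists.1 hQ
  obtain ⟨g, ⟨i, hi⟩, hg⟩ := h s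
  refine Ideal.comap_lt_comap_of_root_mem_sdiff hle ⟨hs', hs⟩ (p := g) (fun h0 => ?_) hg
  have := congrArg (Polynomial.coeff · i) h0
  have hp : (Q.comap (algebraMap V T)).IsPrime := inferInstance
  simp only [Polynomial.coeff_map, hi, map_one, Polynomial.coeff_zero] at this
  exact one_ne_zero this

/-- Any `t` satisfies a primitive relation with a fixed `s ∈ Q' \ Q`; reducing it modulo `Q` and
using that `s` vanishes modulo `Q'` leaves a relation on `t` alone. -/
theorem Ideal.residueAlgebraic_of_comap_eq {V T : Type*} [CommRing V] [IsDomain V]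
    [ValuationRing V] [CommRing T] [IsDomain T] [Algebra V T] [FaithfulSMul V T]
    (htr : Algebra.trdeg V T ≤ 1) {Q Q' : Ideal T} [Q.IsPrime] [Q'.IsPrime] (hQ : Q < Q')
    (heq : Q.comap (algebraMap V T) = Q'.comap (algebraMap V T)) : Q'.ResidueAlgebraic V := by
  intro t
  obtain ⟨hle, s, hs', hs⟩ := SetLike.lt_iff_le_and_exists.1 hQ
  -- The content of such an `h` is outside `Q'`, so it can be divided out.
  suffices H : ∃ h : V[X], Polynomial.aeval t h ∈ Q' ∧
      ∃ i, h.coeff i ∉ Q'.comap (algebraMap V T) by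
    obtain ⟨h, hh, i, hi⟩ := H
    have h0 : h ≠ 0 := by rintro rfl; simp at hi
    obtain ⟨c, h', rfl, hc⟩ := ValuationRing.exists_eq_C_mul h0
    refine ⟨h', hc, ?_⟩
    rw [map_mul, Polynomial.aeval_C] at hh
    refine (Ideal.IsPrime.mem_or_mem ‹_› hh).resolve_left fun hcq => hi ?_
    rw [Polynomial.coeff_C_mul]
    exact Ideal.mul_mem_right _ _ hcq
  obtain ⟨g, hg, hgz⟩ := Algebra.exists_aevalAeval_eq_zero_of_trdeg_le_one htr t s
  obtain ⟨c, h, rfl, i, j, hij⟩ := ValuationRing.exists_eq_C_C_mul hg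
  have hc : c ≠ 0 := by rintro rfl; simp at hg
  have hz : h.eval₂ (Polynomial.aeval t : V[X] →ₐ[V] T).toRingHom s = 0 := by
    have hev : ∀ p : V[X][X], Polynomial.aevalAeval t s p =
        p.eval₂ (Polynomial.aeval t : V[X] →ₐ[V] T).toRingHom s := fun p => by
      induction p using Polynomial.induction_on' with
      | add p q hp hq => rw [map_add, Polynomial.eval₂_add, hp, hq]
      | monomial n a => simp [← Polynomial.C_mul_X_pow_eq_monomial]
    rw [map_mul] at hgz
    rw [← hev]
    refine (mul_eq_zero.1 hgz).resolve_left ?_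
    simpa using hc
  have hone : (1 : V) ∉ Q'.comap (algebraMap V T) := by
    rw [← Ideal.ne_top_iff_one]; exact Ideal.IsPrime.ne_top'
  by_cases h0 : h.map (Ideal.Quotient.mk
      (Q.comap (Polynomial.aeval t : V[X] →ₐ[V] T).toRingHom)) = 0
  · refine ⟨h.coeff i, ?_, j, by rwa [hij]⟩
    have := congrArg (Polynomial.coeff · i) h0
    simp only [Polynomial.coeff_map, Polynomial.coeff_zero, Ideal.Quotient.eq_zero_iff_mem] at this
    exact hle this
  -- Some coefficient `h_k(t)` lies in `Q'` but not in `Q`. Were all coefficients of `h_k` in the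
  -- common contraction, `h_k(t)` would lie in `Q`.
  · obtain ⟨k, hk', hk⟩ := Ideal.exists_coeff_mem_comap_sdiff_comap_of_root_mem_sdiff hle
      ⟨hs', hs⟩ h0 (by rw [hz]; exact Q.zero_mem)
    refine ⟨h.coeff k, hk', ?_⟩
    by_contra! hall
    refine hk ?_
    rw [← heq] at hall
    change Polynomial.aeval t (h.coeff k) ∈ Q
    rw [Polynomial.aeval_eq_sum_range]
    refine Ideal.sum_mem _ fun l _ => ?_
    rw [Algebra.smul_def]
    exact Ideal.mul_mem_right _ _ (hall l)

-- The height of the contraction, plus 1 if the prime is residue algebraic, is strictly increasing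
-- on primes of `T`: where the contraction stays equal, the flag must go from 0 to 1. Its values are
-- at most `dim V + 1`.
open Classical in
theorem ringKrullDim_le_add_one_of_trdeg_le_one (V T : Type*) [CommRing V] [IsDomain V]
    [ValuationRing V] [CommRing T] [IsDomain T] [Algebra V T] [FaithfulSMul V T]
    (htr : Algebra.trdeg V T ≤ 1) : ringKrullDim T ≤ ringKrullDim V + 1 := by
  obtain htop | hfin := eq_or_ne (ringKrullDim V) ⊤
  · rw [htop]; exact le_top
  obtain ⟨n, hn⟩ : ∃ n : ℕ, ringKrullDim V = n := by
    have : ringKrullDim V ≠ ⊥ := fun h => by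
      have := ringKrullDim_nonneg_of_nontrivial (R := V)
      simp [h] at this
    generalize ringKrullDim V = d at *
    induction d with
    | bot => exact absurd rfl this
    | coe d =>
      induction d with
      | top => exact absurd rfl hfin
      | coe d => exact ⟨d, rfl⟩
  have hle : ∀ q : PrimeSpectrum V, Order.height q ≤ n := fun q => by
    have := Order.height_le_krullDim q
    rw [← ringKrullDim, hn] at this
    exact_mod_cast this
  let c : PrimeSpectrum T → PrimeSpectrum V := PrimeSpectrum.comap (algebraMap V T)
  have hht : ∀ Q, ((Order.height (c Q)).toNat : ℕ∞) = Order.height (c Q) := fun Q =>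
    ENat.natCast_toNat (ne_top_of_le_ne_top (ENat.natCast_ne_top n) (hle _))
  let φ : PrimeSpectrum T → ℕ := fun Q =>
    (Order.height (c Q)).toNat + if Q.asIdeal.ResidueAlgebraic V then 1 else 0
  have hφ : StrictMono φ := fun Q Q' hQ => by
    have hcle : c Q ≤ c Q' := Ideal.comap_mono hQ.le
    have halg : Q.asIdeal.ResidueAlgebraic V → Q'.asIdeal.ResidueAlgebraic V :=
      fun h => h.mono hQ.le
    obtain heq | hlt := hcle.eq_or_lt
    · have h' : Q'.asIdeal.ResidueAlgebraic V := Ideal.residueAlgebraic_of_comap_eq htr hQ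
        (congrArg PrimeSpectrum.asIdeal heq)
      have h : ¬ Q.asIdeal.ResidueAlgebraic V := fun h =>
        (h.comap_lt_comap hQ).ne (congrArg PrimeSpectrum.asIdeal heq)
      simp [φ, h, h', heq]
    · have := Order.height_strictMono hlt ((hle _).trans_lt (ENat.natCast_lt_top n))
      rw [← hht Q, ← hht Q', Nat.cast_lt] at this
      simp only [φ]
      split_ifs <;> first | omega | tauto
  have hbd : ∀ Q, φ Q < n + 2 := fun Q => by
    have := hle (c Q)
    rw [← hht Q, Nat.cast_le] at this
    simp only [φ]
    split_ifs <;> omega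
  rw [hn]
  refine iSup_le fun p => ?_
  have h := Order.length_le_height_last (p := p.map φ hφ)
  rw [Order.height_nat, Nat.cast_le] at h
  have h1 : p.length ≤ φ p.last := by simpa using h
  have h2 := hbd p.last
  exact_mod_cast (by omega : p.length ≤ n + 1)

/-! ### Coefficients of integer-valued polynomials. -/

theorem integerValuedPolynomials.coeff_mem_ofField {R K : Type*} [CommRing R] [IsDomain R]
    [Field K] [Algebra R K] [IsFractionRing R K] (q : Ideal R) [q.IsPrime] [Infinite (R ⧸ q)]
    {f : K[X]} (hf : f ∈ integerValuedPolynomials R K) (n : ℕ) :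
    f.coeff n ∈ Localization.subalgebra.ofField K q.primeCompl
      q.primeCompl_le_nonZeroDivisors := by
  classical
  set A := Localization.subalgebra.ofField K q.primeCompl q.primeCompl_le_nonZeroDivisors
  obtain ⟨t, ht⟩ := Infinite.exists_subset_card_eq (R ⧸ q) (f.natDegree + 1)
  let r : R ⧸ q → R := Quotient.out
  have hr : ∀ i, Ideal.Quotient.mk q (r i) = i := fun i => Ideal.Quotient.mk_out i
  let v : R ⧸ q → K := fun i => algebraMap R K (r i)
  have hrange : ∀ x : R, algebraMap R K x ∈ Set.range (algebraMap A K) := fun x =>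
    ⟨algebraMap R A x, rfl⟩
  have hv : Function.Injective v := fun i j hij => by
    rw [← hr i, ← hr j, IsFractionRing.injective R K hij]
  have hfd : f.degree < t.card := by
    rw [ht]
    exact Polynomial.degree_le_natDegree.trans_lt (by exact_mod_cast Nat.lt_succ_self _)
  have hlift : f ∈ Polynomial.liftsRing (algebraMap A K) := by
    rw [Lagrange.eq_interpolate hv.injOn hfd, Lagrange.interpolate_apply]
    refine sum_mem fun i _ => mul_mem ?_ (prod_mem fun j hj => mul_mem ?_ (sub_mem ?_ ?_))
    all_goals rw [← Polynomial.lifts_iff_liftsRing]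
    · obtain ⟨x, hx⟩ := hf (r i)
      exact Polynomial.C'_mem_lifts (hx ▸ hrange x)
    -- The nodes represent distinct classes modulo `q`, so their differences are invertible in
    -- `R_q`.
    · refine Polynomial.C'_mem_lifts ⟨⟨(v i - v j)⁻¹, 1, r i - r j, ?_, ?_⟩, rfl⟩
      · intro h
        have := Ideal.Quotient.eq_zero_iff_mem.2 h
        rw [map_sub, hr, hr, sub_eq_zero] at this
        exact Finset.ne_of_mem_erase hj this.symm
      · simp [v]
    · exact Polynomial.X_mem_lifts _
    · exact Polynomial.C'_mem_lifts (hrange _)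
  rw [← Polynomial.lifts_iff_liftsRing, Polynomial.lifts_iff_coeff_lifts] at hlift
  obtain ⟨a, ha⟩ := hlift n
  exact ha ▸ a.2

theorem infinite_quotient_of_isPrime_of_lt {R : Type*} [CommRing R] {q p : Ideal R} [q.IsPrime]
    [p.IsPrime] (h : q < p) : Infinite (R ⧸ q) := by
  by_contra hfin
  rw [not_infinite_iff_finite] at hfin
  have : q.IsMaximal := Ideal.Quotient.maximal_of_isField _ (Finite.isField_of_domain _)
  exact Ideal.IsPrime.ne_top' (this.1.2 _ h)

theorem ValuationRing.of_atPrime_maximalIdeal {V : Type*} [CommRing V] [IsDomain V] [IsLocalRing V]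
    (h : ValuationRing (Localization.AtPrime (IsLocalRing.maximalIdeal V))) :
    ValuationRing V := by
  let e := IsLocalization.atUnits V (IsLocalRing.maximalIdeal V).primeCompl
    (S := Localization.AtPrime (IsLocalRing.maximalIdeal V)) (fun x hx => by
      simpa [IsUnit.mem_submonoid_iff, Ideal.mem_primeCompl_iff] using hx)
  exact Function.Surjective.valuationRing e.symm.toRingEquiv.toRingHom e.symm.surjective

/-- If the localization `V` at a prime is essential, then it either is a valuation ring or contains
the coefficients of the integer-valued polynomials. -/
theorem IsEssentialDomain.valuationRing_or_coeff_mem {R K V : Type*} [CommRing R] [IsDomain R]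
    [Field K] [Algebra R K] [IsFractionRing R K] (p : Ideal R) [hp : p.IsPrime]
    [CommRing V] [IsDomain V] [Algebra R V] [IsLocalization.AtPrime V p]
    (hV : IsEssentialDomain V) :
    ValuationRing V ∨
      ∀ f ∈ integerValuedPolynomials R K, ∀ n, f.coeff n ∈
        Localization.subalgebra.ofField K p.primeCompl p.primeCompl_le_nonZeroDivisors := by
  have := IsLocalization.AtPrime.isLocalRing V p
  obtain ⟨Δ, hΔ, hbot⟩ := hV
  by_cases hm : IsLocalRing.closedPoint V ∈ Δ
  · exact .inl (ValuationRing.of_atPrime_maximalIdeal (hΔ _ hm))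
  refine .inr fun f hf n => ?_
  obtain ⟨a, b, hb, hab⟩ := IsFractionRing.div_surjective R (f.coeff n)
  have hb0 : b ≠ 0 := nonZeroDivisors.ne_zero hb
  let ι : R →+* V := algebraMap R _
  have hι : Function.Injective ι :=
    IsLocalization.injective _ p.primeCompl_le_nonZeroDivisors
  let j : V →+* FractionRing V := algebraMap V (FractionRing V)
  have hj : Function.Injective j := IsFractionRing.injective _ _
  have hjb : j (ι b) ≠ 0 := by
    rw [ne_eq, map_eq_zero_iff j hj, map_eq_zero_iff ι hι]; exact hb0
  have hbK : algebraMap R K b ≠ 0 := by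
    rwa [ne_eq, map_eq_zero_iff _ (IsFractionRing.injective R K)]
  -- The coefficient `a / b` of `K` is transported to the fraction field of `V`, where the
  -- intersection is taken.
  have hmem : j (ι a) / j (ι b) ∈ (⨅ q ∈ Δ, Localization.subalgebra.ofField
      (FractionRing V) q.asIdeal.primeCompl
      q.asIdeal.primeCompl_le_nonZeroDivisors) := by
    simp only [Algebra.mem_iInf]
    intro q hq
    have hlt : q.asIdeal < IsLocalRing.maximalIdeal V :=
      (IsLocalRing.le_maximalIdeal Ideal.IsPrime.ne_top').lt_of_ne fun h => by
        refine hm ?_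
        rwa [show IsLocalRing.closedPoint V = q from
          PrimeSpectrum.ext h.symm]
    have hcomap : q.asIdeal.comap ι < p := by
      refine lt_of_le_of_ne ?_ fun h => ?_
      · exact (Ideal.comap_mono hlt.le).trans (IsLocalization.AtPrime.under_maximalIdeal V p).le
      · refine hlt.ne ?_
        rw [← IsLocalization.AtPrime.map_eq_maximalIdeal p V,
          ← IsLocalization.map_under p.primeCompl V q.asIdeal]
        exact congrArg _ h
    have := infinite_quotient_of_isPrime_of_lt hcomap
    obtain ⟨r, d, hd, hrd⟩ := integerValuedPolynomials.coeff_mem_ofField (q.asIdeal.comap ι) hf n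
    have hd0 : d ≠ 0 := by rintro rfl; exact hd (by simp)
    have hdK : algebraMap R K d ≠ 0 := by
      rwa [ne_eq, map_eq_zero_iff _ (IsFractionRing.injective R K)]
    have hjd : j (ι d) ≠ 0 := by
      rw [ne_eq, map_eq_zero_iff j hj, map_eq_zero_iff ι hι]; exact hd0
    have key : a * d = r * b := IsFractionRing.injective R K (by
      rw [← hab, div_eq_iff hbK] at hrd
      rw [map_mul, map_mul, hrd]
      field_simp)
    refine ⟨ι r, ι d, hd, ?_⟩
    change _ = j (ι r) * (j (ι d))⁻¹
    rw [← div_eq_mul_inv, div_eq_div_iff hjb hjd, ← map_mul, ← map_mul, key, map_mul, map_mul]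
  rw [hbot] at hmem
  obtain ⟨w, hw⟩ := Algebra.mem_bot.1 hmem
  obtain ⟨r, u, rfl⟩ := IsLocalization.exists_mk'_eq p.primeCompl w
  have key : a * u = b * r := hι (hj (by
    have h1 : j (ι a) = j (ι b) * j (IsLocalization.mk' _ r u) := by
      rw [eq_div_iff hjb] at hw
      rw [← hw, mul_comm]
    have h2 : IsLocalization.mk' V r u * ι u = ι r :=
      IsLocalization.mk'_spec _ r u
    rw [map_mul, map_mul, map_mul, map_mul, h1, mul_assoc, ← map_mul j _ (ι u), h2]))
  have hu0 : (u : R) ≠ 0 := fun h => u.2 (h ▸ p.zero_mem)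
  have huK : algebraMap R K u ≠ 0 := by
    rwa [ne_eq, map_eq_zero_iff _ (IsFractionRing.injective R K)]
  refine ⟨r, u, u.2, ?_⟩
  rw [← hab, ← div_eq_mul_inv, div_eq_div_iff hbK huK, ← map_mul, ← map_mul, key, mul_comm]

/-! ### Heights and localization. -/

theorem IsLocalization.height_le_ringKrullDim {A : Type*} (B : Type*) [CommRing A] [CommRing B]
    [Algebra A B] (M : Submonoid A) [IsLocalization M B] (P : Ideal A) [P.IsPrime]
    (hP : Disjoint (M : Set A) P) : (P.height : WithBot ℕ∞) ≤ ringKrullDim B := by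
  have := IsLocalization.isPrime_of_isPrime_disjoint M B P ‹_› hP
  rw [← IsLocalization.height_map_of_disjoint (S := B) M P hP]
  exact Ideal.height_le_ringKrullDim_of_isPrime

theorem IsLocalization.ringKrullDim_le {A : Type*} (B : Type*) [CommRing A] [CommRing B]
    [Algebra A B] (M : Submonoid A) [IsLocalization M B] : ringKrullDim B ≤ ringKrullDim A := by
  rw [ringKrullDim_le_iff_height_le]
  intro P hP
  rw [← IsLocalization.height_under M P]
  exact Ideal.height_le_ringKrullDim_of_isPrime

/-- Elements of `T` are fractions over `A` with denominators in `M`, so inverting `M` in `T` adds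
nothing beyond the localization of `A`. -/
theorem isLocalization_localization_algebraMapSubmonoid {A T : Type*} [CommRing A] [CommRing T]
    [Algebra A T] [FaithfulSMul A T] (M : Submonoid A)
    (h : ∀ t : T, ∃ m ∈ M, ∃ a, algebraMap A T m * t = algebraMap A T a) :
    IsLocalization M (Localization (Algebra.algebraMapSubmonoid T M)) where
  map_units m := by
    rw [IsScalarTower.algebraMap_apply A T]
    exact IsLocalization.map_units _ (⟨_, m, m.2, rfl⟩ : Algebra.algebraMapSubmonoid T M)
  surj z := by
    obtain ⟨⟨t, ⟨_, m, hm, rfl⟩⟩, ht⟩ :=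
      IsLocalization.surj (Algebra.algebraMapSubmonoid T M) z
    obtain ⟨m', hm', a, ha⟩ := h t
    refine ⟨(a, ⟨m * m', mul_mem hm hm'⟩), ?_⟩
    dsimp only at ht ⊢
    rw [IsScalarTower.algebraMap_apply A T, IsScalarTower.algebraMap_apply A T _ a, ← ha]
    simp only [map_mul]
    rw [← mul_assoc, ht, mul_comm]
  exists_of_eq {x y} hxy := by
    rw [IsScalarTower.algebraMap_apply A T, IsScalarTower.algebraMap_apply A T _ y] at hxy
    obtain ⟨⟨_, m, hm, rfl⟩, hc⟩ :=
      IsLocalization.exists_of_eq (M := Algebra.algebraMapSubmonoid T M) hxy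
    refine ⟨⟨m, hm⟩, FaithfulSMul.algebraMap_injective A T ?_⟩
    simpa using hc

theorem Ideal.height_le_ringKrullDim_add_one_of_trdeg_le_one {R T : Type*} [CommRing R]
    [IsDomain R] [CommRing T] [IsDomain T] [Algebra R T] [FaithfulSMul R T]
    (htr : Algebra.trdeg R T ≤ 1) (p : Ideal R) [p.IsPrime]
    (hV : ValuationRing (Localization.AtPrime p)) (Q : Ideal T) [Q.IsPrime] [Q.LiesOver p] :
    (Q.height : WithBot ℕ∞) ≤ ringKrullDim R + 1 := by
  let _ := Localization.AtPrime.algebraOfLiesOver p Q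
  have hRV : FaithfulSMul R (Localization.AtPrime p) := inferInstance
  have hTQ : FaithfulSMul T (Localization.AtPrime Q) := inferInstance
  have hRQ : FaithfulSMul R (Localization.AtPrime Q) := .trans R T _
  have hVQ : FaithfulSMul (Localization.AtPrime p) (Localization.AtPrime Q) := by
    rw [faithfulSMul_iff_algebraMap_injective]
    rw [injective_iff_map_eq_zero]
    intro x hx
    obtain ⟨r, u, rfl⟩ := IsLocalization.exists_mk'_eq p.primeCompl x
    have h := congrArg (algebraMap (Localization.AtPrime p) (Localization.AtPrime Q))
      (IsLocalization.mk'_spec (Localization.AtPrime p) r u)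
    rw [map_mul, hx, zero_mul, ← IsScalarTower.algebraMap_apply] at h
    rw [(map_eq_zero_iff _ (FaithfulSMul.algebraMap_injective R _)).1 h.symm,
      IsLocalization.mk'_zero]
  have halg := IsLocalization.isAlgebraic (Localization.AtPrime Q) Q.primeCompl
  have h1 : Algebra.trdeg R (Localization.AtPrime Q) ≤ 1 := by
    rw [← trdeg_add_eq R T, trdeg_eq_zero (R := T), add_zero]
    exact htr
  -- Additivity of transcendence degree in the tower `R → R_p → T_Q`.
  have h2 : Algebra.trdeg (Localization.AtPrime p) (Localization.AtPrime Q) ≤ 1 := by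
    rw [← Cardinal.lift_le]
    have := lift_trdeg_add_eq R (Localization.AtPrime p) (Localization.AtPrime Q)
    exact (le_add_left le_rfl).trans (this.le.trans (by simpa using h1))
  rw [← IsLocalization.AtPrime.ringKrullDim_eq_height Q (Localization.AtPrime Q)]
  refine (ringKrullDim_le_add_one_of_trdeg_le_one (Localization.AtPrime p) _ h2).trans ?_
  gcongr
  exact IsLocalization.ringKrullDim_le _ p.primeCompl

/-! ### `Int(R)` between `R[X]` and `K[X]`. -/

namespace integerValuedPolynomials

variable (R K : Type*) [CommRing R] [Field K] [Algebra R K]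

/-- A polynomial over `R`, seen as an integer-valued polynomial. -/
noncomputable def ofPolynomial : R[X] →ₐ[R] integerValuedPolynomials R K :=
  (Polynomial.mapAlg R K).codRestrict _ fun g r => ⟨g.eval r, by
    rw [Polynomial.mapAlg_eq_map, Polynomial.eval_map_algebraMap, Polynomial.aeval_algebraMap_apply,
      Polynomial.coe_aeval_eq_eval]⟩

theorem coe_ofPolynomial (g : R[X]) :
    (ofPolynomial R K g : K[X]) = g.map (algebraMap R K) :=
  Polynomial.mapAlg_eq_map _ _

variable {R K} in
theorem exists_ofPolynomial_mul_eq [IsDomain R] [IsFractionRing R K] (p : Ideal R) [p.IsPrime]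
    (f : integerValuedPolynomials R K)
    (hf : ∀ n, (f : K[X]).coeff n ∈
      Localization.subalgebra.ofField K p.primeCompl p.primeCompl_le_nonZeroDivisors) :
    ∃ s ∈ p.primeCompl, ∃ g, ofPolynomial R K (Polynomial.C s) * f = ofPolynomial R K g := by
  set A := Localization.subalgebra.ofField K p.primeCompl p.primeCompl_le_nonZeroDivisors
  have hlift : (f : K[X]) ∈ Polynomial.lifts (algebraMap A K) := by
    rw [Polynomial.lifts_iff_coeff_lifts]
    exact fun n => ⟨⟨_, hf n⟩, rfl⟩
  obtain ⟨F, hF⟩ := (Polynomial.mem_lifts _).1 hlift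
  obtain ⟨s, hsp, hs⟩ := IsLocalization.integerNormalization_spec p.primeCompl F
  refine ⟨s, hsp, IsLocalization.integerNormalization p.primeCompl F, Subtype.ext ?_⟩
  rw [MulMemClass.coe_mul, coe_ofPolynomial, coe_ofPolynomial, ← hF,
    IsScalarTower.algebraMap_eq R A K, ← Polynomial.map_map, ← Polynomial.map_map,
    ← Polynomial.map_mul, hs, Polynomial.map_C, Algebra.smul_def]
  rfl

/-- Evaluation at 0 maps onto `R` and kills the nonzerodivisor `X`. -/
theorem ringKrullDim_add_one_le [IsDomain R] [IsFractionRing R K] :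
    ringKrullDim R + 1 ≤ ringKrullDim (integerValuedPolynomials R K) := by
  let e : R →+* (algebraMap R K).range := (algebraMap R K).rangeRestrict
  have he : Function.Bijective e :=
    ⟨fun x y h => IsFractionRing.injective R K (congrArg Subtype.val h),
      (algebraMap R K).rangeRestrict_surjective⟩
  let φ : integerValuedPolynomials R K →+* (algebraMap R K).range :=
    ((Polynomial.evalRingHom (0 : K)).comp (integerValuedPolynomials R K).val.toRingHom).codRestrict
      _ fun f => by simpa using f.2 0
  rw [ringKrullDim_eq_of_ringEquiv (RingEquiv.ofBijective e he)]
  refine ringKrullDim_succ_le_of_surjective φ (fun y => ?_)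
    (r := ofPolynomial R K Polynomial.X) ?_ ?_
  · obtain ⟨x, rfl⟩ := he.2 y
    refine ⟨ofPolynomial R K (Polynomial.C x), Subtype.ext ?_⟩
    change Polynomial.eval 0 (ofPolynomial R K (Polynomial.C x) : K[X]) = algebraMap R K x
    simp [coe_ofPolynomial]
  · refine mem_nonZeroDivisors_of_ne_zero fun h => ?_
    have := congrArg Subtype.val h
    simp [coe_ofPolynomial] at this
  · refine Subtype.ext ?_
    change Polynomial.eval 0 (ofPolynomial R K Polynomial.X : K[X]) = 0
    simp [coe_ofPolynomial]

theorem trdeg_le_one [IsDomain R] [IsFractionRing R K] :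
    Algebra.trdeg R (integerValuedPolynomials R K) ≤ 1 := by
  have := IsFractionRing.injective R K
  have : FaithfulSMul R K := (faithfulSMul_iff_algebraMap_injective R K).2 this
  have hRK : Algebra.IsAlgebraic R K := IsLocalization.isAlgebraic K (nonZeroDivisors R)
  have h := lift_trdeg_add_eq R K K[X]
  rw [trdeg_eq_zero, Polynomial.trdeg_of_isDomain] at h
  refine (trdeg_le_of_injective (integerValuedPolynomials R K).val
    Subtype.val_injective).trans ?_
  simpa using h.ge

end integerValuedPolynomials

/-! ### Comparison of the two dimensions. -/

theorem mainTheorem1 (R : Type*) [CommRing R] [IsDomain R]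
    (K : Type*) [Field K] [Algebra R K] [IsFractionRing R K]
    (hR : IsLocallyEssentialDomain R) :
    ringKrullDim (integerValuedPolynomials R K) = ringKrullDim R[X] := by
  set T := integerValuedPolynomials R K
  have hRK : FaithfulSMul R K :=
    (faithfulSMul_iff_algebraMap_injective R K).2 (IsFractionRing.injective R K)
  have hRT : FaithfulSMul R T :=
    (faithfulSMul_iff_algebraMap_injective R T).2 fun x y h =>
      FaithfulSMul.algebraMap_injective R K[X] (congrArg Subtype.val h)
  let _ : Algebra R[X] T := (integerValuedPolynomials.ofPolynomial R K).toAlgebra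
  have hinj : FaithfulSMul R[X] T :=
    (faithfulSMul_iff_algebraMap_injective R[X] T).2 fun x y h => by
      refine Polynomial.map_injective _ (IsFractionRing.injective R K) ?_
      rw [← integerValuedPolynomials.coe_ofPolynomial, ← integerValuedPolynomials.coe_ofPolynomial]
      exact congrArg Subtype.val h
  have : IsScalarTower R R[X] T := .of_algHom (integerValuedPolynomials.ofPolynomial R K)
  let M (p : Ideal R) [p.IsPrime] : Submonoid R[X] := Algebra.algebraMapSubmonoid R[X] p.primeCompl
  have hdich (p : Ideal R) [hp : p.IsPrime] : ValuationRing (Localization.AtPrime p) ∨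
      IsLocalization (M p) (Localization (Algebra.algebraMapSubmonoid T (M p))) := by
    refine ((hR ⟨p, hp⟩).valuationRing_or_coeff_mem (K := K) p).imp_right fun h => ?_
    refine isLocalization_localization_algebraMapSubmonoid (M p) fun f => ?_
    obtain ⟨s, hs, g, hg⟩ :=
      integerValuedPolynomials.exists_ofPolynomial_mul_eq p f (h f f.2)
    exact ⟨_, ⟨s, hs, rfl⟩, g, hg⟩
  apply le_antisymm
  · rw [ringKrullDim_le_iff_height_le]
    intro Q hQ
    obtain hV | hloc := hdich (Q.under R)
    · exact (Ideal.height_le_ringKrullDim_add_one_of_trdeg_le_one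
        (integerValuedPolynomials.trdeg_le_one R K) (Q.under R) hV Q).trans
        ringKrullDim_succ_le_ringKrullDim_polynomial
    · refine (IsLocalization.height_le_ringKrullDim
        (Localization (Algebra.algebraMapSubmonoid T (M (Q.under R))))
        (Algebra.algebraMapSubmonoid T (M (Q.under R))) Q ?_).trans
        (IsLocalization.ringKrullDim_le _ (M (Q.under R)))
      rw [Set.disjoint_left]
      rintro _ ⟨_, ⟨s, hs, rfl⟩, rfl⟩ h
      refine hs ?_
      rw [← IsScalarTower.algebraMap_apply] at h
      exact h
  · rw [ringKrullDim_le_iff_height_le]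
    intro P hP
    obtain hV | hloc := hdich (P.under R)
    · exact (Ideal.height_le_ringKrullDim_add_one_of_trdeg_le_one
        Polynomial.trdeg_of_isDomain.le (P.under R) hV P).trans
        (integerValuedPolynomials.ringKrullDim_add_one_le R K)
    · refine (IsLocalization.height_le_ringKrullDim
        (Localization (Algebra.algebraMapSubmonoid T (M (P.under R)))) (M (P.under R)) P ?_).trans
        (IsLocalization.ringKrullDim_le _ (Algebra.algebraMapSubmonoid T (M (P.under R))))
      rw [Set.disjoint_left]
      rintro _ ⟨s, hs, rfl⟩ h
      exact hs h
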